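/- **Corollary 2.2.** Let $S_\infty$ be the group of all permutations of $\mathbb N$, with the Polish topology inherited from the Baire space $\mathbb N^{\mathbb N}$. For a countable relational language $L=\{R_i\}_{i\in I}$, with $R_i$ of arity $n_i$, let $X_L=\prod_{i\in I}2^{\mathbb N^{n_i}}$ (with the product topology) be the space of $L$-structures with universe $\mathbb N$. The logic action of $S_\infty$ on $X_L$ is $(g\cdot x)_i(s_0,\dots,s_{n_i-1})=x_i(g^{-1}(s_0),\dots,g^{-1}(s_{n_i-1}))$; its orbits are the isomorphism classes. For a Polish group $G$, a *Borel $G$-space* is a standard Borel space with a Borel action $G\times X\to X$, and a *Polish $G$-space* is a Polish space with a continuous action $G\times X\to X$. A Borel $G$-space $U$ is *universal* if for every Borel $G$-space $X$ there is a Borel injection $\pi:X\to U$ with $\pi(g\cdot x)=g\cdot\pi(x)$ for all $g\in G$, $x\in X$. *Vaught's conjecture for $L_{\omega_1\omega}$* is the assertion that for every countable relational language $L$ and every $L_{\omega_1\omega}$-sentence $\varphi$, either the models of $\varphi$ in $X_L$ fall into countably many isomorphism classes, or there is a nonempty perfect set $P\subseteq X_L$ of pairwise non-isomorphic models of $\varphi$.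 The *Topological Vaught Conjecture for $G$* has three forms. * $\mathrm{TVC}_I(G)$: for every Polish $G$-space $X$ and every invariant Borel set $B\subseteq X$, either $B$ contains only countably many orbits or there is a nonempty perfect set $P\subseteq B$ any two distinct members of which belong to different orbits. * $\mathrm{TVC}_{II}(G)$: the same as $\mathrm{TVC}_I(G)$, but with $B=X$. * $\mathrm{TVC}_{III}(G)$: every Borel $G$-space $X$ either has only countably many orbits or contains an uncountable Borel set $P\subseteq X$ any two distinct members of which belong to different orbits. Let $L_\infty=\{R_n\}_{n\in\mathbb N}$ be the language with exactly one $n$-ary relation symbol $R_n$ for each $n\in\mathbb N$, so that $X_{L_\infty}=\prod_n 2^{\mathbb N^n}$ can be identified with $X_\infty=2^{\mathbb N^{<\mathbb N}}$. Then: 1. The logic action of $S_\infty$ on $X_{L_\infty}$ is a universal Borel $S_\infty$-space. 2. Vaught's conjecture for $L_{\omega_1\omega}$ is equivalent to the Topological Vaught Conjecture for $S_\infty$, that is, to each one of $\mathrm{TVC}_I(S_\infty)$, $\mathrm{TVC}_{II}(S_\infty)$ and $\mathrm{TVC}_{III}(S_\infty)$. -/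

import Mathlib

universe u

namespace LogicActions

/-! ### The Polish group of all permutations of the natural numbers -/

/-- The group `S_∞` of all permutations of `ℕ`. -/
abbrev SInf : Type := Equiv.Perm ℕ

/-- The topology that `S_∞` inherits from the Baire space `ℕ → ℕ`. -/
instance instTopSInf : TopologicalSpace SInf :=
  TopologicalSpace.induced (fun (g : SInf) (n : ℕ) => g n) inferInstance

instance instMeasSInf : MeasurableSpace SInf := borel SInf

instance instBorelSInf : BorelSpace SInf := ⟨rfl⟩

theorem continuous_apply_SInf (n : ℕ) : Continuous fun g : SInf => g n :=
  (continuous_apply n).comp continuous_induced_dom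

theorem isOpen_apply_eq (n m : ℕ) : IsOpen {g : SInf | g n = m} :=
  (isOpen_discrete ({m} : Set ℕ)).preimage (continuous_apply_SInf n)

theorem continuous_SInf_iff {X : Type*} [TopologicalSpace X] {f : X → SInf} :
    Continuous f ↔ ∀ n, Continuous fun x => f x n :=
  continuous_induced_rng.trans continuous_pi_iff

instance instGroupSInf : IsTopologicalGroup SInf where
  continuous_mul := by
    rw [continuous_SInf_iff]
    intro n
    rw [continuous_discrete_rng]
    intro m
    have h : (fun p : SInf × SInf => (p.1 * p.2) n) ⁻¹' {m} =
        ⋃ k : ℕ, {g : SInf | g k = m} ×ˢ {g : SInf | g n = k} := by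
      ext p
      simp
    rw [h]
    exact isOpen_iUnion fun k => (isOpen_apply_eq k m).prod (isOpen_apply_eq n k)
  continuous_inv := by
    rw [continuous_SInf_iff]
    intro n
    rw [continuous_discrete_rng]
    intro m
    have h : (fun g : SInf => g⁻¹ n) ⁻¹' {m} = {g : SInf | g m = n} := by
      ext g
      simp only [Set.mem_preimage, Set.mem_singleton_iff, Set.mem_ofPred_eq]
      rw [Equiv.Perm.inv_eq_iff_eq, eq_comm]
    rw [h]
    exact isOpen_apply_eq m n

instance instPolishSInf : PolishSpace SInf := by
  let F : SInf → (ℕ → ℕ) × (ℕ → ℕ) := fun g => (fun n => g n, fun n => g⁻¹ n)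
  have hc : Continuous F :=
    (continuous_pi continuous_apply_SInf).prodMk
      (continuous_pi fun n => (continuous_apply_SInf n).comp continuous_inv)
  have hi : Topology.IsInducing F :=
    Topology.IsInducing.of_comp hc continuous_fst ⟨rfl⟩
  have hinj : Function.Injective F := fun g h e => by
    ext n
    exact congrFun (congrArg Prod.fst e) n
  have hr : Set.range F = {p | (∀ n, p.1 (p.2 n) = n) ∧ ∀ n, p.2 (p.1 n) = n} := by
    ext p
    constructor
    · rintro ⟨g, rfl⟩
      simp [F]
    · rintro ⟨h1, h2⟩
      exact ⟨⟨p.1, p.2, h2, h1⟩, rfl⟩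
  have happ : Continuous fun q : (ℕ → ℕ) × ℕ => q.1 q.2 := by
    rw [continuous_discrete_rng]
    intro m
    have h : (fun q : (ℕ → ℕ) × ℕ => q.1 q.2) ⁻¹' {m} =
        ⋃ k : ℕ, {f : ℕ → ℕ | f k = m} ×ˢ {k} := by
      ext q
      simp
    rw [h]
    refine isOpen_iUnion fun k => IsOpen.prod ?_ (isOpen_discrete _)
    have hk : Continuous fun f : ℕ → ℕ => f k := continuous_apply k
    exact (isOpen_discrete ({m} : Set ℕ)).preimage hk
  have hcl : IsClosed (Set.range F) := by
    rw [hr, Set.ofPred_and, Set.ofPred_forall, Set.ofPred_forall]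
    refine (isClosed_iInter fun n => ?_).inter (isClosed_iInter fun n => ?_)
    · exact isClosed_eq (happ.comp (continuous_fst.prodMk
        ((continuous_apply n).comp continuous_snd))) continuous_const
    · exact isClosed_eq (happ.comp (continuous_snd.prodMk
        ((continuous_apply n).comp continuous_fst))) continuous_const
  exact Topology.IsClosedEmbedding.polishSpace ⟨⟨hi, hinj⟩, hcl⟩

/-! ### Numbers of equivalence classes -/

/-- Only countably many classes of the equivalence relation `r` meet `B`. -/
def CountablyManyClasses {X : Type*} (r : Setoid X) (B : Set X) : Prop :=
  (Quotient.mk r '' B).Countable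

/-- `B` contains a nonempty perfect set whose distinct members are pairwise inequivalent. -/
def PerfectlyManyClasses {X : Type*} [TopologicalSpace X] (r : Setoid X) (B : Set X) : Prop :=
  ∃ P : Set X, P ⊆ B ∧ Perfect P ∧ P.Nonempty ∧ P.Pairwise fun x y => ¬ r x y

/-! ### Universal Borel `G`-spaces and the Topological Vaught Conjecture

For a Polish group `G`, a Borel `G`-space is a standard Borel space with an action of `G` such that
`(g, x) ↦ g • x` is Borel (`MeasurableSMul₂`); a Polish `G`-space is a Polish space with a
continuous action of `G` (`ContinuousSMul`). -/

section Actions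

variable (G : Type) [Group G] [TopologicalSpace G] [IsTopologicalGroup G] [PolishSpace G]

/-- `U` is a universal Borel `G`-space: it is a Borel `G`-space, and every Borel `G`-space admits
a `G`-equivariant Borel injection into it. -/
def IsUniversalBorelSpace [MeasurableSpace G] [BorelSpace G]
    (U : Type) [MeasurableSpace U] [MulAction G U] : Prop :=
  StandardBorelSpace U ∧ MeasurableSMul₂ G U ∧
    ∀ (X : Type u) [MeasurableSpace X] [StandardBorelSpace X] [MulAction G X]
      [MeasurableSMul₂ G X],
      ∃ π : X → U, Measurable π ∧ Function.Injective π ∧ ∀ (g : G) (x : X), π (g • x) = g • π x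

/-- First form of the Topological Vaught Conjecture for `G`: an invariant Borel subset of a Polish
`G`-space contains countably many or perfectly many orbits. -/
def TVCI : Prop :=
  ∀ (X : Type u) [TopologicalSpace X] [PolishSpace X] [MulAction G X] [ContinuousSMul G X]
    (B : Set X), @MeasurableSet X (borel X) B → (∀ (g : G), ∀ x ∈ B, g • x ∈ B) →
    CountablyManyClasses (MulAction.orbitRel G X) B ∨
      PerfectlyManyClasses (MulAction.orbitRel G X) B

/-- Second form: a Polish `G`-space has countably many or perfectly many orbits. -/
def TVCII : Prop :=
  ∀ (X : Type u) [TopologicalSpace X] [PolishSpace X] [MulAction G X] [ContinuousSMul G X],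
    CountablyManyClasses (MulAction.orbitRel G X) Set.univ ∨
      PerfectlyManyClasses (MulAction.orbitRel G X) Set.univ

/-- Third form: a Borel `G`-space has countably many orbits or contains an uncountable Borel set
whose distinct members lie in different orbits. -/
def TVCIII [MeasurableSpace G] [BorelSpace G] : Prop :=
  ∀ (X : Type u) [MeasurableSpace X] [StandardBorelSpace X] [MulAction G X] [MeasurableSMul₂ G X],
    CountablyManyClasses (MulAction.orbitRel G X) Set.univ ∨
      ∃ P : Set X, MeasurableSet P ∧ ¬ P.Countable ∧
        P.Pairwise fun x y => ¬ MulAction.orbitRel G X x y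

end Actions

/-! ### The logic action -/

section LogicAction

variable (L : FirstOrder.Language.{0, 0})

/-- The space `∏ 2^(ℕ^n)`, a factor for each `n`-ary relation symbol of `L`, whose points are the
structures with universe `ℕ` for the relational language `L`. -/
def StrSpace : Type :=
  ∀ R : (Σ n, L.Relations n), (Fin R.1 → ℕ) → Bool

/-- The product topology, `Bool` being discrete. -/
instance instTopStrSpace : TopologicalSpace (StrSpace L) :=
  inferInstanceAs (TopologicalSpace (∀ R : (Σ n, L.Relations n), (Fin R.1 → ℕ) → Bool))

instance instMeasStrSpace : MeasurableSpace (StrSpace L) := borel (StrSpace L)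

instance instBorelStrSpace : BorelSpace (StrSpace L) := ⟨rfl⟩

/-- The logic action of `S_∞`. -/
instance instActionStrSpace : MulAction SInf (StrSpace L) where
  smul g x := fun R s => x R fun i => g⁻¹ (s i)
  one_smul _ := rfl
  mul_smul g h x := by
    funext R s
    change x R (fun i => (g * h)⁻¹ (s i)) = x R (fun i => h⁻¹ (g⁻¹ (s i)))
    simp [mul_inv_rev]

variable {L}

/-- The structure with universe `ℕ` given by a point of the space of structures. -/
@[reducible] def StrSpace.toStructure [L.IsRelational] (x : StrSpace L) : L.Structure ℕ where
  funMap f := isEmptyElim f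
  RelMap R s := x ⟨_, R⟩ s = true

variable (L)

/-- Isomorphism of structures, as an equivalence relation on the space of structures. -/
def isoSetoid [L.IsRelational] : Setoid (StrSpace L) where
  r x y := Nonempty (@FirstOrder.Language.Equiv L ℕ ℕ x.toStructure y.toStructure)
  iseqv :=
    { refl := fun x => ⟨@FirstOrder.Language.Equiv.refl L ℕ x.toStructure⟩
      symm := fun {x y} ⟨e⟩ => ⟨@FirstOrder.Language.Equiv.symm L ℕ ℕ x.toStructure y.toStructure e⟩
      trans := fun {x y z} ⟨e⟩ ⟨f⟩ =>
        ⟨@FirstOrder.Language.Equiv.comp L ℕ ℕ x.toStructure y.toStructure ℕ z.toStructure f e⟩ }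

end LogicAction

/-! ### The infinitary logic `L_{ω₁ω}` -/

/-- `L_{ω₁ω}`-formulas whose free variables are among `n` variables (indexed by `Fin n`): countable
conjunctions and disjunctions are allowed, and quantifiers bind one variable, the last one. -/
inductive InfFormula (L : FirstOrder.Language.{0, 0}) : ℕ → Type
  | falsum {n : ℕ} : InfFormula L n
  | equal {n : ℕ} (t₁ t₂ : L.Term (Fin n)) : InfFormula L n
  | rel {n k : ℕ} (R : L.Relations k) (ts : Fin k → L.Term (Fin n)) : InfFormula L n
  | neg {n : ℕ} (φ : InfFormula L n) : InfFormula L n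
  | conj {n : ℕ} (φ : ℕ → InfFormula L n) : InfFormula L n
  | disj {n : ℕ} (φ : ℕ → InfFormula L n) : InfFormula L n
  | all {n : ℕ} (φ : InfFormula L (n + 1)) : InfFormula L n
  | ex {n : ℕ} (φ : InfFormula L (n + 1)) : InfFormula L n

/-- Satisfaction of an `L_{ω₁ω}`-formula in a structure `M` at a tuple `v`. -/
def InfFormula.Realize {L : FirstOrder.Language.{0, 0}} {M : Type} [L.Structure M] :
    {n : ℕ} → InfFormula L n → (Fin n → M) → Prop
  | _, .falsum, _ => False
  | _, .equal t₁ t₂, v => t₁.realize v = t₂.realize v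
  | _, .rel R ts, v => FirstOrder.Language.Structure.RelMap R fun i => (ts i).realize v
  | _, .neg φ, v => ¬ φ.Realize v
  | _, .conj φ, v => ∀ i, (φ i).Realize v
  | _, .disj φ, v => ∃ i, (φ i).Realize v
  | _, .all φ, v => ∀ a : M, φ.Realize (Fin.snoc v a)
  | _, .ex φ, v => ∃ a : M, φ.Realize (Fin.snoc v a)

/-- The set of models with universe `ℕ` of an `L_{ω₁ω}`-sentence. -/
def InfFormula.models {L : FirstOrder.Language.{0, 0}} [L.IsRelational] (φ : InfFormula L 0) :
    Set (StrSpace L) :=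
  {x | @InfFormula.Realize L ℕ x.toStructure 0 φ Fin.elim0}

/-- Vaught's conjecture for `L_{ω₁ω}`: every `L_{ω₁ω}`-sentence in a countable relational language
has countably many or perfectly many countably infinite models, up to isomorphism. -/
def VaughtConjecture : Prop :=
  ∀ (L : FirstOrder.Language.{0, 0}) [L.IsRelational] [Countable L.Symbols] (φ : InfFormula L 0),
    CountablyManyClasses (isoSetoid L) φ.models ∨ PerfectlyManyClasses (isoSetoid L) φ.models

/-- The language with exactly one `n`-ary relation symbol for each `n`. -/
def LInf : FirstOrder.Language.{0, 0} where
  Functions _ := Empty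
  Relations _ := Unit

end LogicActions

open Set Filter Topology MeasureTheory

namespace LogicActions

/-! ### Counting classes -/

section Classes

variable {X Y : Type*} {r : Setoid X} {r' : Setoid Y} {B : Set X}

/-! Everything rests on Baire category in `S_∞`. Given Borel sets `A m` separating the points of a
Borel `S_∞`-space, code `x` by recording for which `m` and `s` the set of `g` with `g • x ∈ A m` is
nonmeagre in the cylinder `cyl s`. The coding is Borel by induction on Borel sets
(`measurableSet_not_isMeagre_section`) and equivariant because right translations are
homeomorphisms. It is injective: if `x` and `y` have equal codes, then for generic `g` the points `g
• x` and `g • y` lie in the same sets `A m`, so they coincide. This is universality.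

The same category quantifier, applied to structures, can be written in `L_{ω₁ω}`, which gives
Lopez-Escobar's theorem `exists_models_eq`. Under Vaught's conjecture, an invariant Borel set is
therefore carried by the universal embedding onto the models of a sentence, and a perfect set of
models pulls back to a Borel set of inequivalent points.

Conversely, the topology on structures can be refined, keeping it Polish and the action continuous,
so that a given formula defines clopen sets (`InfFormula.exists_polishRefinement`). The models of a
sentence then form a Polish `S_∞`-space, and a Borel set in the original topology, so each
topological form applies to them. -/

theorem countablyManyClasses_iff : CountablyManyClasses r B ↔
    ∃ C ⊆ B, C.Countable ∧ ∀ x ∈ B, ∃ c ∈ C, r c x := by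
  constructor
  · intro h
    obtain ⟨C, hCB, hC⟩ := Set.exists_subset_bijOn B (Quotient.mk r)
    refine ⟨C, hCB, Set.countable_of_injective_of_countable_image hC.injOn (hC.image_eq ▸ h), ?_⟩
    intro x hx
    obtain ⟨c, hc, hcx⟩ := hC.surjOn (Set.mem_image_of_mem _ hx)
    exact ⟨c, hc, Quotient.exact hcx⟩
  · rintro ⟨C, -, hC, h⟩
    refine (hC.image (Quotient.mk r)).mono ?_
    rintro _ ⟨x, hx, rfl⟩
    obtain ⟨c, hc, hcx⟩ := h x hx
    exact ⟨c, hc, Quotient.sound hcx⟩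

theorem countablyManyClasses_image_iff {f : X → Y}
    (hf : ∀ x ∈ B, ∀ y ∈ B, r x y ↔ r' (f x) (f y)) :
    CountablyManyClasses r' (f '' B) ↔ CountablyManyClasses r B := by
  rw [countablyManyClasses_iff, countablyManyClasses_iff]
  constructor
  · rintro ⟨C, hCB, hC, h⟩
    have hCB' : ∀ c : C, ∃ x ∈ B, f x = c := fun c => hCB c.2
    choose g hgB hg using hCB'
    have := hC.to_subtype
    refine ⟨range g, range_subset_iff.2 hgB, countable_range g, fun x hx => ?_⟩
    obtain ⟨c, hc, hcx⟩ := h (f x) (Set.mem_image_of_mem f hx)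
    exact ⟨g ⟨c, hc⟩, mem_range_self _, (hf _ (hgB _) _ hx).2 (by rwa [hg])⟩
  · rintro ⟨C, hCB, hC, h⟩
    refine ⟨f '' C, Set.image_mono hCB, hC.image f, ?_⟩
    rintro _ ⟨x, hx, rfl⟩
    obtain ⟨c, hc, hcx⟩ := h x hx
    exact ⟨f c, Set.mem_image_of_mem f hc, (hf _ (hCB hc) _ hx).1 hcx⟩

theorem not_countable_range_cantor {f : (ℕ → Bool) → X} (hf : Function.Injective f) :
    ¬ (range f).Countable := by
  classical
  intro h
  have := h.to_subtype
  obtain ⟨e, he⟩ := exists_injective_nat (range f)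
  refine Function.cantor_injective
    (fun s : Set ℕ => e ⟨f fun n => decide (n ∈ s), mem_range_self _⟩) fun s t hst => ?_
  have := hf (Subtype.ext_iff.1 (he hst))
  ext n
  simpa using congrFun this n

/-- In a Polish space, perfectly many classes are witnessed by a copy of the Cantor space. -/
theorem perfectlyManyClasses_iff_exists_cantor [TopologicalSpace X] [PolishSpace X] :
    PerfectlyManyClasses r B ↔ ∃ f : (ℕ → Bool) → X, Continuous f ∧ Function.Injective f ∧
      (∀ a, f a ∈ B) ∧ ∀ a b, a ≠ b → ¬ r (f a) (f b) := by
  constructor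
  · rintro ⟨P, hPB, hP, hne, hpw⟩
    let := TopologicalSpace.upgradeIsCompletelyMetrizable X
    obtain ⟨f, hfP, hf, hinj⟩ := hP.exists_nat_bool_injection hne
    exact ⟨f, hf, hinj, fun a => hPB (hfP (mem_range_self a)), fun a b hab =>
      hpw (hfP (mem_range_self a)) (hfP (mem_range_self b)) (hinj.ne hab)⟩
  · rintro ⟨f, hf, hinj, hB, hpw⟩
    obtain ⟨P, hP, hne, hPf⟩ := exists_perfect_nonempty_of_isClosed_of_not_countable
      (isCompact_range hf).isClosed (not_countable_range_cantor hinj)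
    refine ⟨P, fun x hx => ?_, hP, hne, fun x hx y hy hxy => ?_⟩
    · obtain ⟨a, rfl⟩ := hPf hx
      exact hB a
    · obtain ⟨a, rfl⟩ := hPf hx
      obtain ⟨b, rfl⟩ := hPf hy
      exact hpw a b fun h => hxy (h ▸ rfl)

/-- A continuous injective image of a perfect set need not be closed, so the transfer goes through a
Cantor set, whose image is compact. -/
theorem PerfectlyManyClasses.map [TopologicalSpace X] [PolishSpace X] [TopologicalSpace Y]
    [PolishSpace Y] {B' : Set Y} (h : PerfectlyManyClasses r B) {f : X → Y} (hf : Continuous f)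
    (hinj : Function.Injective f) (hB : MapsTo f B B')
    (hr : ∀ x y, r' (f x) (f y) → r x y) : PerfectlyManyClasses r' B' := by
  rw [perfectlyManyClasses_iff_exists_cantor] at h ⊢
  obtain ⟨c, hc, hci, hcB, hcr⟩ := h
  exact ⟨f ∘ c, hf.comp hc, hinj.comp hci, fun a => hB (hcB a), fun a b hab h =>
    hcr a b hab (hr _ _ h)⟩

/-- Refine the topology to make `P` closed and apply the perfect set theorem there; the resulting
map stays continuous for the coarser topology. -/
theorem exists_cantor_of_measurableSet [TopologicalSpace X] [PolishSpace X] [MeasurableSpace X]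
    [BorelSpace X] {P : Set X} (hP : MeasurableSet P) (hunc : ¬ P.Countable) :
    ∃ f : (ℕ → Bool) → X, range f ⊆ P ∧ Continuous f ∧ Function.Injective f := by
  obtain ⟨t', ht', hpol, hcl, -⟩ := hP.isClopenable
  obtain ⟨f, hfP, hf, hinj⟩ :=
    @IsClosed.exists_nat_bool_injection_of_not_countable X t' hpol P hcl hunc
  exact ⟨f, hfP, continuous_le_rng ht' hf, hinj⟩

theorem perfectlyManyClasses_of_measurableSet [TopologicalSpace X] [PolishSpace X]
    [MeasurableSpace X] [BorelSpace X] {P : Set X} (hP : MeasurableSet P) (hunc : ¬ P.Countable)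
    (hPB : P ⊆ B) (hpw : P.Pairwise fun x y => ¬ r x y) : PerfectlyManyClasses r B := by
  obtain ⟨f, hfP, hf, hinj⟩ := exists_cantor_of_measurableSet hP hunc
  exact perfectlyManyClasses_iff_exists_cantor.2 ⟨f, hf, hinj,
    fun a => hPB (hfP (mem_range_self a)), fun a b hab =>
      hpw (hfP (mem_range_self a)) (hfP (mem_range_self b)) (hinj.ne hab)⟩

end Classes

theorem not_countable_of_perfect {X : Type*} [TopologicalSpace X] [PolishSpace X] {P : Set X}
    (hP : Perfect P) (hne : P.Nonempty) : ¬ P.Countable := by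
  let := TopologicalSpace.upgradeIsCompletelyMetrizable X
  obtain ⟨f, hfP, -, hinj⟩ := hP.exists_nat_bool_injection hne
  exact fun h => not_countable_range_cantor hinj (h.mono hfP)

theorem orbitRel_map_iff {G X Y : Type*} [Group G] [MulAction G X] [MulAction G Y] {f : X → Y}
    (hinj : Function.Injective f) (hf : ∀ (g : G) x, f (g • x) = g • f x) (x y : X) :
    MulAction.orbitRel G X x y ↔ MulAction.orbitRel G Y (f x) (f y) := by
  simp only [MulAction.orbitRel_apply, MulAction.mem_orbit_iff, ← hf, hinj.eq_iff]

/-! ### Basic open sets of `S_∞` and category -/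

instance instBaireSInf : BaireSpace SInf := by
  let := TopologicalSpace.upgradeIsCompletelyMetrizable SInf
  infer_instance

/-- The basic open set of all `g` whose inverse extends the finite sequence `s`. -/
def cyl {n : ℕ} (s : Fin n → ℕ) : Set SInf := {g | ∀ i : Fin n, g⁻¹ i = s i}

theorem isOpen_inv_apply_eq (n m : ℕ) : IsOpen {g : SInf | g⁻¹ n = m} :=
  (isOpen_apply_eq n m).preimage continuous_inv

theorem isOpen_cyl {n : ℕ} (s : Fin n → ℕ) : IsOpen (cyl s) := by
  simp only [cyl, Set.ofPred_forall]
  exact isOpen_iInter_of_finite fun i => isOpen_inv_apply_eq i (s i)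

/-- `S_∞` is `n`-transitive for every `n`, so a finite injection extends to a permutation. -/
theorem cyl_nonempty {n : ℕ} {s : Fin n → ℕ} (hs : Function.Injective s) : (cyl s).Nonempty := by
  obtain ⟨g, hg⟩ := (Equiv.Perm.isMultiplyPretransitive ℕ n).exists_smul_eq
    ⟨fun i : Fin n => (i : ℕ), Fin.val_injective⟩ ⟨s, hs⟩
  refine ⟨g⁻¹, fun i => ?_⟩
  rw [inv_inv]
  exact DFunLike.congr_fun hg i

theorem not_isMeagre_cyl {n : ℕ} {s : Fin n → ℕ} (hs : Function.Injective s) :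
    ¬ IsMeagre (cyl s) :=
  not_isMeagre_of_isOpen (isOpen_cyl s) (cyl_nonempty hs)

theorem injective_restrict_inv (g : SInf) (n : ℕ) :
    Function.Injective fun i : Fin n => g⁻¹ (i : ℕ) :=
  (g⁻¹).injective.comp Fin.val_injective

theorem cyl_subset_cyl {n m : ℕ} {s : Fin n → ℕ} {t : Fin (n + m) → ℕ}
    (h : ∀ i, t (Fin.castAdd m i) = s i) : cyl t ⊆ cyl s := fun g hg i => by
  rw [← h i, ← hg (Fin.castAdd m i)]
  rfl

theorem exists_cyl_subset {U : Set SInf} (hU : IsOpen U) {g : SInf} (hg : g ∈ U) :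
    ∃ m : ℕ, ∀ n, m ≤ n → cyl (fun i : Fin n => g⁻¹ (i : ℕ)) ⊆ U := by
  have hV : IsOpen ((fun h : SInf => h⁻¹) ⁻¹' U) := hU.preimage continuous_inv
  obtain ⟨W, hW, hWU⟩ := isOpen_induced_iff.1 hV
  have hgW : (fun n => g⁻¹ n : ℕ → ℕ) ∈ W := by
    have : g⁻¹ ∈ (fun h : SInf => h⁻¹) ⁻¹' U := by simpa using hg
    rwa [← hWU] at this
  obtain ⟨I, u, hu, hIu⟩ := isOpen_pi_iff.1 hW _ hgW
  -- Long enough to fix every coordinate in the finite set `I`.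
  refine ⟨I.sup id + 1, fun n hn h hh => ?_⟩
  have : h⁻¹ ∈ (fun h : SInf => h⁻¹) ⁻¹' U := by
    rw [← hWU]
    refine hIu fun i hi => ?_
    have hin : i < n := lt_of_lt_of_le (Nat.lt_succ_of_le (Finset.le_sup (f := id) hi)) hn
    have := hh ⟨i, hin⟩
    change h⁻¹ i = g⁻¹ i at this
    change h⁻¹ i ∈ u i
    rw [this]
    exact (hu i hi).2
  simpa using this

/-- By the Baire property, a nonmeagre Borel set is comeagre in some smaller cylinder. This turns
negation into a countable existential over longer sequences, the key to both inductions on Borel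
sets. Injectivity of `t` keeps `cyl t` nonmeagre. -/
theorem not_isMeagre_compl_inter_cyl_iff {A : Set SInf} (hA : MeasurableSet A) {n : ℕ}
    (s : Fin n → ℕ) : ¬ IsMeagre (Aᶜ ∩ cyl s) ↔ ∃ (m : ℕ) (t : Fin (n + m) → ℕ),
      (∀ i, t (Fin.castAdd m i) = s i) ∧ Function.Injective t ∧ IsMeagre (A ∩ cyl t) := by
  constructor
  · intro h
    obtain ⟨u, hu, hAu⟩ := (hA.compl.inter (isOpen_cyl s).measurableSet).residualEq_isOpen
    have hdiff : IsMeagre (u \ (Aᶜ ∩ cyl s)) := by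
      filter_upwards [hAu] with g hg hgu
      exact hgu.2 (hg.symm ▸ hgu.1 : (Aᶜ ∩ cyl s) g)
    have hne : (u ∩ cyl s).Nonempty := by
      by_contra hemp
      rw [Set.not_nonempty_iff_eq_empty] at hemp
      refine h ?_
      filter_upwards [hAu] with g hg hgA
      have : g ∈ u ∩ cyl s := ⟨(hg ▸ hgA : u g), hgA.2⟩
      rw [hemp] at this
      exact this
    obtain ⟨g, hgu, hgs⟩ := hne
    obtain ⟨m, hm⟩ := exists_cyl_subset hu hgu
    refine ⟨m, fun i => g⁻¹ (i : ℕ), fun i => hgs i, injective_restrict_inv g _, ?_⟩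
    refine hdiff.mono ?_
    exact fun h hh => ⟨hm (n + m) (Nat.le_add_left m n) hh.2, fun h' => h'.1 hh.1⟩
  · rintro ⟨m, t, hts, ht, hmt⟩ h
    refine not_isMeagre_cyl ht ((hmt.union h).mono ?_)
    intro g hg
    by_cases hgA : g ∈ A
    · exact Or.inl ⟨hgA, hg⟩
    · exact Or.inr ⟨hgA, cyl_subset_cyl hts hg⟩

theorem not_isMeagre_iUnion_inter_iff {ι : Sort*} [Countable ι] {X : Type*} [TopologicalSpace X]
    (A : ι → Set X) (C : Set X) :
    ¬ IsMeagre ((⋃ i, A i) ∩ C) ↔ ∃ i, ¬ IsMeagre (A i ∩ C) := by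
  rw [← not_forall, not_iff_not, Set.iUnion_inter]
  exact ⟨fun h i => h.mono (subset_iUnion (fun i => A i ∩ C) i), fun h => isMeagre_iUnion h⟩

/-- Otherwise `A \ B` is comeagre in some nonempty cylinder; there `B` is meagre, hence so is `A`,
and the cylinder itself would be meagre. -/
theorem isMeagre_diff_of_forall_cyl {A B : Set SInf} (hA : MeasurableSet A) (hB : MeasurableSet B)
    (h : ∀ (n : ℕ) (s : Fin n → ℕ), IsMeagre (B ∩ cyl s) → IsMeagre (A ∩ cyl s)) :
    IsMeagre (A \ B) := by
  by_contra hne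
  have hne' : ¬ IsMeagre ((Aᶜ ∪ B)ᶜ ∩ cyl (Fin.elim0 : Fin 0 → ℕ)) := by
    refine fun h' => hne (h'.mono ?_)
    refine fun g hg => ⟨?_, fun i => i.elim0⟩
    simpa using hg
  obtain ⟨m, t, -, ht, hm⟩ := (not_isMeagre_compl_inter_cyl_iff (hA.compl.union hB) _).1 hne'
  have hAt := h _ t (hm.mono (Set.inter_subset_inter_left _ subset_union_right))
  refine not_isMeagre_cyl ht ((hm.union hAt).mono ?_)
  intro g hg
  by_cases hgA : g ∈ A
  · exact Or.inr ⟨hgA, hg⟩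
  · exact Or.inl ⟨Or.inl hgA, hg⟩

theorem isMeagre_preimage_homeomorph_iff {X Y : Type*} [TopologicalSpace X] [TopologicalSpace Y]
    (e : X ≃ₜ Y) {s : Set Y} : IsMeagre (e ⁻¹' s) ↔ IsMeagre s := by
  refine ⟨fun h => ?_, fun h => h.preimage_of_isOpenMap e.continuous e.isOpenMap⟩
  have := h.preimage_of_isOpenMap e.symm.continuous e.symm.isOpenMap
  rwa [← Set.preimage_comp, e.self_comp_symm, Set.preimage_id] at this

/-! ### The space of structures -/

section StrSpace

variable (L : FirstOrder.Language.{0, 0})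

theorem countable_relations [Countable L.Symbols] : Countable (Σ n, L.Relations n) :=
  have : Countable ((Σ n, L.Functions n) ⊕ (Σ n, L.Relations n)) := ‹Countable L.Symbols›
  (Sum.inr_injective (α := Σ n, L.Functions n) (β := Σ n, L.Relations n)).countable

theorem isClopen_atomic (R : Σ n, L.Relations n) (t : Fin R.1 → ℕ) (b : Bool) :
    IsClopen {x : StrSpace L | x R t = b} := by
  have h : Continuous fun x : StrSpace L => x R t :=
    (continuous_apply t).comp
      (continuous_apply (A := fun R : (Σ n, L.Relations n) => (Fin R.1 → ℕ) → Bool) R)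
  exact (isClopen_discrete {b}).preimage h

theorem continuous_strSpace_iff {Z : Type*} [TopologicalSpace Z] {f : Z → StrSpace L} :
    Continuous f ↔ ∀ R t, Continuous fun z => f z R t :=
  continuous_pi_iff.trans (forall_congr' fun _ => continuous_pi_iff)

instance instPolishStrSpace [Countable L.Symbols] : PolishSpace (StrSpace L) :=
  have := countable_relations L
  { toSecondCountableTopology := inferInstanceAs
      (SecondCountableTopology (∀ R : (Σ n, L.Relations n), (Fin R.1 → ℕ) → Bool))
    toIsCompletelyMetrizableSpace := inferInstanceAs (TopologicalSpace.IsCompletelyMetrizableSpace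
      (∀ R : (Σ n, L.Relations n), (Fin R.1 → ℕ) → Bool)) }

theorem smul_strSpace_apply (g : SInf) (x : StrSpace L) (R : Σ n, L.Relations n)
    (t : Fin R.1 → ℕ) : (g • x) R t = x R fun i => g⁻¹ (t i) := rfl

instance instContinuousSMulStrSpace : ContinuousSMul SInf (StrSpace L) where
  continuous_smul := by
    refine (continuous_strSpace_iff L).2 fun R t => ?_
    rw [continuous_discrete_rng]
    intro b
    have h : (fun p : SInf × StrSpace L => (p.1 • p.2) R t) ⁻¹' {b} =
        ⋃ s : Fin R.1 → ℕ, {g : SInf | ∀ i, g⁻¹ (t i) = s i} ×ˢ {x : StrSpace L | x R s = b} := by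
      ext p
      simp only [Set.mem_preimage, smul_strSpace_apply, Set.mem_singleton_iff, Set.mem_iUnion,
        Set.mem_prod, Set.mem_ofPred_eq]
      constructor
      · exact fun h => ⟨fun i => p.1⁻¹ (t i), fun _ => rfl, h⟩
      · rintro ⟨s, hs, h⟩
        rwa [funext hs]
    rw [h]
    refine isOpen_iUnion fun s => IsOpen.prod ?_ (isClopen_atomic L R s b).isOpen
    simp only [Set.ofPred_forall]
    exact isOpen_iInter_of_finite fun i => isOpen_inv_apply_eq (t i) (s i)

theorem strSpace_borel_eq_generateFrom [Countable L.Symbols] :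
    instMeasStrSpace L = MeasurableSpace.generateFrom
      {S | ∃ (R : Σ n, L.Relations n) (t : Fin R.1 → ℕ), S = {x : StrSpace L | x R t = true}} := by
  have := countable_relations L
  refine le_antisymm ?_ (MeasurableSpace.generateFrom_le ?_)
  · have hid : @Measurable (StrSpace L) (∀ R : (Σ n, L.Relations n), (Fin R.1 → ℕ) → Bool)
        (MeasurableSpace.generateFrom {S | ∃ (R : Σ n, L.Relations n) (t : Fin R.1 → ℕ),
          S = {x : StrSpace L | x R t = true}}) MeasurableSpace.pi id :=
      (@measurable_pi_iff _ _ _ (_) _ _).2 fun R => (@measurable_pi_iff _ _ _ (_) _ _).2 fun t =>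
        @measurable_to_bool _ (_) _ (MeasurableSpace.measurableSet_generateFrom ⟨R, t, rfl⟩)
    have hpi : instMeasStrSpace L =
        MeasurableSpace.pi (X := fun R : (Σ n, L.Relations n) => (Fin R.1 → ℕ) → Bool) :=
      (BorelSpace.measurable_eq (α := ∀ R : (Σ n, L.Relations n), (Fin R.1 → ℕ) → Bool)).symm
    rw [hpi]
    exact fun S hS => hid hS
  · rintro _ ⟨R, t, rfl⟩
    exact (isClopen_atomic L R t true).isOpen.measurableSet

theorem measurable_strSpace [Countable L.Symbols] {Z : Type*} [MeasurableSpace Z]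
    {f : Z → StrSpace L} (h : ∀ R t, MeasurableSet {z | f z R t = true}) : Measurable f := by
  rw [Measurable, strSpace_borel_eq_generateFrom L]
  refine measurable_generateFrom ?_
  rintro _ ⟨R, t, rfl⟩
  exact h R t

end StrSpace

instance instRelationalLInf : LInf.IsRelational := fun _ => inferInstanceAs (IsEmpty Empty)

instance instCountableLInf : Countable LInf.Symbols :=
  inferInstanceAs (Countable ((Σ _ : ℕ, Empty) ⊕ (Σ _ : ℕ, Unit)))

/-! ### Universality of the logic action -/

section Universal

variable {X : Type*}

/-- The category quantifier "for nonmeagerly many `g` in a basic open set" preserves Borel sets. -/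
theorem measurableSet_not_isMeagre_section [MeasurableSpace X] {B : Set (X × SInf)} (hB : MeasurableSet B) :
    ∀ {n : ℕ} (s : Fin n → ℕ),
      MeasurableSet {x | ¬ IsMeagre ({g | (x, g) ∈ B} ∩ cyl s)} := by
  -- `n` and `s` stay quantified, since the complement case passes to longer sequences.
  induction B, hB using MeasurableSpace.induction_on_inter
    generateFrom_prod.symm isPiSystem_prod with
  | empty => simp [IsMeagre.empty]
  | basic C hC =>
    obtain ⟨A, hA, V, hV, rfl⟩ := hC
    intro n s
    have : {x | ¬ IsMeagre ({g | (x, g) ∈ A ×ˢ V} ∩ cyl s)} =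
        A ∩ {_x | ¬ IsMeagre (V ∩ cyl s)} := by
      ext x
      by_cases hx : x ∈ A <;> simp [hx, IsMeagre.empty]
    rw [this]
    exact MeasurableSet.inter hA (MeasurableSet.const _)
  | compl C hC ih =>
    intro n s
    have : {x | ¬ IsMeagre ({g | (x, g) ∈ Cᶜ} ∩ cyl s)} = ⋃ (m : ℕ) (t : Fin (n + m) → ℕ),
        {_x | (∀ i, t (Fin.castAdd m i) = s i) ∧ Function.Injective t} ∩
          {x | ¬ IsMeagre ({g | (x, g) ∈ C} ∩ cyl t)}ᶜ := by
      ext x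
      have hm : MeasurableSet {g : SInf | (x, g) ∈ C} := measurable_prodMk_left hC
      have := not_isMeagre_compl_inter_cyl_iff hm s
      simp only [Set.mem_iUnion, Set.mem_inter_iff, Set.mem_compl_iff, Set.mem_ofPred_eq, not_not,
        and_assoc]
      exact this
    rw [this]
    exact MeasurableSet.iUnion fun m => MeasurableSet.iUnion fun t =>
      (MeasurableSet.const _).inter (ih t).compl
  | iUnion C _ _ ih =>
    intro n s
    have : {x | ¬ IsMeagre ({g | (x, g) ∈ ⋃ i, C i} ∩ cyl s)} =
        ⋃ i, {x | ¬ IsMeagre ({g | (x, g) ∈ C i} ∩ cyl s)} := by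
      ext x
      have := not_isMeagre_iUnion_inter_iff (fun i => {g : SInf | (x, g) ∈ C i}) (cyl s)
      simp only [Set.mem_iUnion, Set.mem_ofPred_eq]
      rw [← this]
      simp only [Set.ofPred_exists]
    rw [this]
    exact MeasurableSet.iUnion fun i => ih i s

variable [MulAction SInf X]

theorem measurableSet_smul_mem [MeasurableSpace X] [MeasurableSMul₂ SInf X] (x : X) {A : Set X} (hA : MeasurableSet A) :
    MeasurableSet {g : SInf | g • x ∈ A} :=
  (measurable_id.smul measurable_const : Measurable fun g : SInf => g • x) hA

theorem measurableSet_not_isMeagre_smul [MeasurableSpace X] [MeasurableSMul₂ SInf X] {A : Set X} (hA : MeasurableSet A) {n : ℕ}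
    (s : Fin n → ℕ) : MeasurableSet {x : X | ¬ IsMeagre ({g : SInf | g • x ∈ A} ∩ cyl s)} :=
  measurableSet_not_isMeagre_section
    ((measurable_snd.smul measurable_fst : Measurable fun p : X × SInf => p.2 • p.1) hA) s

open Classical in
/-- The structure attached to a point of a Borel `S_∞`-space with a sequence of Borel subsets: the
relation of arity `Nat.pair m k` records on its first `k` arguments `s` whether the `m`-th set
contains `g • x` for nonmeagerly many `g` in `cyl s`. -/
noncomputable def vaughtCode (f : X → ℕ → Bool) (x : X) : StrSpace LInf := fun R s =>
  decide (¬ IsMeagre ({g : SInf | f (g • x) (Nat.unpair R.1).1 = true} ∩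
    cyl fun i : Fin (Nat.unpair R.1).2 => s (Fin.castLE (Nat.unpair_right_le R.1) i)))

/-- With one relation per arity, the arity itself has to encode both `m` and `k`. As `k ≤ Nat.pair m
k`, the tuple `s` fits; the padding by `0` is never read. -/
theorem vaughtCode_pair (f : X → ℕ → Bool) (x : X) {m k : ℕ} (s : Fin k → ℕ) :
    vaughtCode f x ⟨Nat.pair m k, ()⟩ (fun i => if h : i < k then s ⟨i, h⟩ else 0) = true ↔
      ¬ IsMeagre ({g : SInf | f (g • x) m = true} ∩ cyl s) := by
  have h : (cyl fun i : Fin (Nat.unpair (Nat.pair m k)).2 =>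
      (fun i : Fin (Nat.pair m k) => if h : i < k then s ⟨i, h⟩ else 0)
        (Fin.castLE (Nat.unpair_right_le _) i)) = cyl s := by
    have hk : (Nat.unpair (Nat.pair m k)).2 = k := by simp
    ext g
    constructor
    · intro hg i
      simpa using hg ⟨i, lt_of_lt_of_eq i.2 hk.symm⟩
    · intro hg i
      have hi : (i : ℕ) < k := lt_of_lt_of_eq i.2 hk
      simpa [hi] using hg ⟨i, hi⟩
  unfold vaughtCode
  simp only [decide_eq_true_iff]
  rw [h]
  simp only [Nat.unpair_pair]

/-- The sets tested for `h • x` are preimages of those for `x` under `g ↦ g * h`. It is because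
`cyl` constrains `g⁻¹` that this translation acts on `s` by `h⁻¹`. -/
theorem vaughtCode_smul (f : X → ℕ → Bool) (h : SInf) (x : X) :
    vaughtCode f (h • x) = h • vaughtCode f x := by
  funext R s
  rw [smul_strSpace_apply]
  unfold vaughtCode
  rw [decide_eq_decide, not_iff_not]
  refine (iff_of_eq (congrArg IsMeagre ?_)).trans
    (isMeagre_preimage_homeomorph_iff (Homeomorph.mulRight h))
  ext g
  simp only [cyl, Set.mem_inter_iff, Set.mem_ofPred_eq, Set.mem_preimage, Homeomorph.coe_mulRight,
    mul_smul, mul_inv_rev, Equiv.Perm.mul_apply, EmbeddingLike.apply_eq_iff_eq]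

theorem measurable_vaughtCode [MeasurableSpace X] [MeasurableSMul₂ SInf X] {f : X → ℕ → Bool} (hf : Measurable f) :
    Measurable (vaughtCode f) := by
  refine measurable_strSpace LInf fun R t => ?_
  simp only [vaughtCode, decide_eq_true_iff]
  exact measurableSet_not_isMeagre_smul
    (measurableSet_eq_fun ((measurable_pi_apply (Nat.unpair R.1).1).comp hf) measurable_const) _

theorem vaughtCode_injective [MeasurableSpace X] [MeasurableSMul₂ SInf X] {f : X → ℕ → Bool} (hf : Measurable f)
    (hinj : Function.Injective f) : Function.Injective (vaughtCode f) := by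
  have key : ∀ x y : X, vaughtCode f x = vaughtCode f y → ∀ m,
      IsMeagre ({g : SInf | f (g • x) m = true} \ {g : SInf | f (g • y) m = true}) := by
    intro x y hxy m
    have hm : MeasurableSet {x | f x m = true} :=
      measurableSet_eq_fun ((measurable_pi_apply m).comp hf) measurable_const
    refine isMeagre_diff_of_forall_cyl (measurableSet_smul_mem x hm)
      (measurableSet_smul_mem y hm) fun n s => ?_
    rw [← not_imp_not]
    rw [← vaughtCode_pair, ← vaughtCode_pair, hxy]
    exact id
  intro x y hxy
  -- By Baire, one `g` avoids all these differences at once.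
  have hM := isMeagre_iUnion fun m => (key x y hxy m).union (key y x hxy.symm m)
  obtain ⟨g, hg⟩ : (⋃ m, ({g : SInf | f (g • x) m = true} \ {g : SInf | f (g • y) m = true}) ∪
      ({g : SInf | f (g • y) m = true} \ {g : SInf | f (g • x) m = true}))ᶜ.Nonempty := by
    rw [Set.nonempty_compl]
    intro h
    rw [h] at hM
    exact not_isMeagre_of_isOpen isOpen_univ univ_nonempty hM
  refine MulAction.injective g (hinj (funext fun m => ?_))
  simp only [Set.mem_compl_iff, Set.mem_iUnion, not_exists] at hg
  have := hg m
  simp only [Set.mem_union, Set.mem_sdiff, Set.mem_ofPred_eq] at this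
  rw [Bool.eq_iff_iff]
  tauto

end Universal

theorem isUniversalBorelSpace_LInf : IsUniversalBorelSpace.{u} SInf (StrSpace LInf) := by
  refine ⟨inferInstance, inferInstance, fun X _ _ _ _ => ?_⟩
  obtain ⟨f, hf, hinj⟩ := MeasurableSpace.measurable_injection_nat_bool_of_countablySeparated X
  exact ⟨vaughtCode f, measurable_vaughtCode hf, vaughtCode_injective hf hinj, vaughtCode_smul f⟩

/-! ### Definability in `L_{ω₁ω}` and the theorem of Lopez-Escobar -/

/-- The set is open, so nonmeagre means nonempty, and finitely many values of `g⁻¹` decide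
membership. The numbers `t j` become positions in the tuple `u`, so the formula needs no parameters.
-/
theorem not_isMeagre_atomic_inter_cyl_iff {L : FirstOrder.Language.{0, 0}} (x : StrSpace L) (R : Σ n, L.Relations n)
    (t : Fin R.1 → ℕ) {n : ℕ} (s : Fin n → ℕ) :
    ¬ IsMeagre ({g : SInf | (g • x) R t = true} ∩ cyl s) ↔
      ∃ (m : ℕ) (u : Fin (n + m) → ℕ), (∀ i, u (Fin.castAdd m i) = s i) ∧
        Function.Injective u ∧ ∃ h : ∀ j, t j < n + m, x R (fun j => u ⟨t j, h j⟩) = true := by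
  have hopen : IsOpen ({g : SInf | (g • x) R t = true} ∩ cyl s) :=
    ((isClopen_atomic L R t true).isOpen.preimage
      (continuous_id.smul continuous_const : Continuous fun g : SInf => g • x)).inter (isOpen_cyl s)
  constructor
  · intro h
    obtain ⟨g, hg, hgs⟩ := nonempty_of_not_isMeagre h
    -- The sum exceeds every `t j`.
    refine ⟨∑ j, (t j + 1), fun i => g⁻¹ (i : ℕ), hgs, injective_restrict_inv g _,
      fun j => ?_, hg⟩
    have := Finset.single_le_sum (f := fun j => t j + 1) (fun _ _ => Nat.zero_le _)
      (Finset.mem_univ j)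
    exact Nat.lt_of_lt_of_le (Nat.lt_of_succ_le this) (Nat.le_add_left _ _)
  · rintro ⟨m, u, hus, hu, h, hx⟩
    refine not_isMeagre_of_isOpen hopen ?_
    obtain ⟨g, hg⟩ := cyl_nonempty hu
    refine ⟨g, ?_, cyl_subset_cyl hus hg⟩
    rw [Set.mem_ofPred_eq, smul_strSpace_apply, ← hx]
    exact congrArg (x R) (funext fun j => hg ⟨t j, h j⟩)

section Definability

variable {L : FirstOrder.Language.{0, 0}} [L.IsRelational]

/-- Satisfaction of a formula in the structure given by a point of the space of structures. -/
def InfFormula.Holds {n : ℕ} (φ : InfFormula L n) (x : StrSpace L) (v : Fin n → ℕ) : Prop :=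
  @InfFormula.Realize L ℕ x.toStructure n φ v

/-- A relation between structures and `n`-tuples is definable by an `L_{ω₁ω}`-formula. -/
def InfDefinable {n : ℕ} (P : StrSpace L → (Fin n → ℕ) → Prop) : Prop :=
  ∃ φ : InfFormula L n, ∀ x v, φ.Holds x v ↔ P x v

namespace InfDefinable

variable {n : ℕ}

theorem congr {P Q : StrSpace L → (Fin n → ℕ) → Prop} (hP : InfDefinable P)
    (h : ∀ x v, P x v ↔ Q x v) : InfDefinable Q :=
  hP.imp fun _ hφ x v => (hφ x v).trans (h x v)

theorem false : InfDefinable fun (_ : StrSpace L) (_ : Fin n → ℕ) => False :=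
  ⟨.falsum, fun _ _ => Iff.rfl⟩

theorem not {P : StrSpace L → (Fin n → ℕ) → Prop} (hP : InfDefinable P) :
    InfDefinable fun x v => ¬ P x v := by
  obtain ⟨φ, hφ⟩ := hP
  exact ⟨.neg φ, fun x v => not_congr (hφ x v)⟩

theorem iExists {ι : Sort*} [Countable ι] {P : ι → StrSpace L → (Fin n → ℕ) → Prop}
    (hP : ∀ i, InfDefinable (P i)) : InfDefinable fun x v => ∃ i, P i x v := by
  cases isEmpty_or_nonempty ι
  · exact false.congr fun x v => by simp
  · obtain ⟨e, he⟩ := exists_surjective_nat ι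
    choose φ hφ using hP
    exact ⟨.disj fun k => φ (e k), fun x v =>
      (exists_congr fun k => hφ (e k) x v).trans (he.exists (p := fun i => P i x v)).symm⟩

theorem iForall {ι : Sort*} [Countable ι] {P : ι → StrSpace L → (Fin n → ℕ) → Prop}
    (hP : ∀ i, InfDefinable (P i)) : InfDefinable fun x v => ∀ i, P i x v :=
  (iExists fun i => (hP i).not).not.congr fun x v => by simp

theorem and {P Q : StrSpace L → (Fin n → ℕ) → Prop} (hP : InfDefinable P) (hQ : InfDefinable Q) :
    InfDefinable fun x v => P x v ∧ Q x v :=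
  (iForall (P := fun b : Bool => cond b P Q) fun b => by cases b <;> assumption).congr
    fun x v => by simp [and_comm]

theorem exists_snoc {P : StrSpace L → (Fin (n + 1) → ℕ) → Prop} (hP : InfDefinable P) :
    InfDefinable fun x (v : Fin n → ℕ) =>
      ∃ a, P x (Fin.snoc (α := fun _ => ℕ) v a) := by
  obtain ⟨φ, hφ⟩ := hP
  exact ⟨.ex φ, fun x v => exists_congr fun a => hφ x _⟩

theorem exists_extension {m : ℕ} {P : StrSpace L → (Fin (n + m) → ℕ) → Prop}
    (hP : InfDefinable P) : InfDefinable fun x (v : Fin n → ℕ) =>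
      ∃ t : Fin (n + m) → ℕ, (∀ i, t (Fin.castAdd m i) = v i) ∧ P x t := by
  induction m with
  | zero =>
    refine hP.congr fun x v => ⟨fun h => ⟨v, fun i => rfl, h⟩, ?_⟩
    rintro ⟨t, ht, h⟩
    rwa [← show t = v from funext ht]
  | succ m ih =>
    refine (ih hP.exists_snoc).congr fun x v => ⟨?_, ?_⟩
    · rintro ⟨t, ht, a, h⟩
      refine ⟨_, fun i => ?_, h⟩
      rw [← ht i]
      exact Fin.snoc_castSucc (α := fun _ => ℕ) a t (Fin.castAdd m i)
    · rintro ⟨t, ht, h⟩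
      refine ⟨Fin.init (α := fun _ => ℕ) t, ht, t (Fin.last _), ?_⟩
      rwa [Fin.snoc_init_self]

theorem equal (i j : Fin n) : InfDefinable fun (_ : StrSpace L) (v : Fin n → ℕ) => v i = v j :=
  ⟨.equal (.var i) (.var j), fun _ _ => Iff.rfl⟩

theorem injective : InfDefinable fun (_ : StrSpace L) (v : Fin n → ℕ) => Function.Injective v :=
  (iForall fun p : {p : Fin n × Fin n // p.1 ≠ p.2} => (equal (L := L) p.1.1 p.1.2).not).congr
    fun x v => by
      rw [Subtype.forall, Prod.forall]
      exact forall₂_congr fun i j => (not_imp_not : ¬ i = j → ¬ v i = v j ↔ _)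

theorem rel (R : Σ n, L.Relations n) (e : Fin R.1 → Fin n) :
    InfDefinable fun (x : StrSpace L) (v : Fin n → ℕ) => x R (fun i => v (e i)) = true :=
  ⟨.rel R.2 fun i => .var (e i), fun _ _ => Iff.rfl⟩

end InfDefinable

/-- The quantifier over permutations is replaced by first-order quantifiers over injective finite
extensions of `s`, with `s` as the free variables. -/
theorem infDefinable_not_isMeagre [Countable L.Symbols] {A : Set (StrSpace L)}
    (hA : MeasurableSet A) : ∀ n : ℕ, InfDefinable fun x (s : Fin n → ℕ) =>
      ¬ IsMeagre ({g : SInf | g • x ∈ A} ∩ cyl s) := by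
  rw [strSpace_borel_eq_generateFrom L] at hA
  induction A, hA using MeasurableSpace.generateFrom_induction with
  | hC A hA _ =>
    obtain ⟨R, t, rfl⟩ := hA
    intro n
    refine InfDefinable.congr (InfDefinable.iExists fun m => InfDefinable.exists_extension
      (InfDefinable.injective.and (InfDefinable.iExists fun h =>
        InfDefinable.rel R fun j => ⟨t j, h j⟩)))
      fun x s => (not_isMeagre_atomic_inter_cyl_iff x R t s).symm
  | empty => exact fun n => InfDefinable.false.congr fun x s => by simp [IsMeagre.empty]
  | compl A hA ih =>
    rw [← strSpace_borel_eq_generateFrom L] at hA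
    intro n
    refine InfDefinable.congr (InfDefinable.iExists fun m => InfDefinable.exists_extension
      (InfDefinable.injective.and (ih (n + m)).not)) fun x s => ?_
    simp only [not_not]
    exact (not_isMeagre_compl_inter_cyl_iff (measurableSet_smul_mem x hA) s).symm
  | iUnion A _ ih =>
    intro n
    refine (InfDefinable.iExists fun i => ih i n).congr fun x s => ?_
    rw [← not_isMeagre_iUnion_inter_iff]
    simp only [Set.mem_iUnion, Set.ofPred_exists]

/-- **Lopez-Escobar's theorem**: an invariant Borel set of structures is axiomatized by a sentence
of `L_{ω₁ω}`. -/
theorem exists_models_eq [Countable L.Symbols] {A : Set (StrSpace L)} (hA : MeasurableSet A)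
    (hinv : ∀ (g : SInf), ∀ x ∈ A, g • x ∈ A) : ∃ φ : InfFormula L 0, φ.models = A := by
  obtain ⟨φ, hφ⟩ := infDefinable_not_isMeagre hA 0
  refine ⟨φ, Set.ext fun x => (hφ x Fin.elim0).trans ?_⟩
  -- For invariant `A`, the set of `g` with `g • x ∈ A` is empty or everything, so category detects
  -- membership.
  have hcyl : cyl (Fin.elim0 : Fin 0 → ℕ) = univ := Set.eq_univ_of_forall fun g i => i.elim0
  simp only [hcyl, Set.inter_univ]
  constructor
  · intro h
    obtain ⟨g, hg⟩ := nonempty_of_not_isMeagre h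
    simpa using hinv g⁻¹ _ hg
  · intro hx
    rw [show {g : SInf | g • x ∈ A} = univ from Set.eq_univ_of_forall fun g => hinv g x hx]
    exact not_isMeagre_of_isOpen isOpen_univ univ_nonempty

end Definability

/-! ### Refining the topology of a Polish `S_∞`-space -/

/-- Give `X` the topology of the disjoint sum of `s` and `sᶜ`, both Polish. The explicit form of its
open sets serves to check continuity of the action. -/
theorem exists_polishSpace_isClopen {X : Type*} [t : TopologicalSpace X] [PolishSpace X]
    {s : Set X} (hs : IsOpen s) : ∃ t' : TopologicalSpace X, t' ≤ t ∧ @PolishSpace X t' ∧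
      @IsClopen _ t' s ∧ ∀ V, IsOpen[t'] V → ∃ A B, IsOpen[t] A ∧ IsOpen[t] B ∧ V = A ∩ s ∪ B \ s := by
  classical
  have : PolishSpace s := hs.polishSpace
  have : PolishSpace (sᶜ : Set X) := hs.isClosed_compl.polishSpace
  let f : s ⊕ (sᶜ : Set X) ≃ X := Equiv.Set.sumCompl s
  have hopen : ∀ V, IsOpen[.coinduced f instTopologicalSpaceSum] V ↔
      IsOpen ((↑) ⁻¹' V : Set s) ∧ IsOpen ((↑) ⁻¹' V : Set (sᶜ : Set X)) := by
    intro V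
    rw [isOpen_coinduced, isOpen_sum_iff]
    exact Iff.rfl
  refine ⟨.coinduced f instTopologicalSpaceSum, fun V hV => (hopen V).2
    ⟨hV.preimage continuous_subtype_val, hV.preimage continuous_subtype_val⟩, ?_, ⟨?_, ?_⟩, ?_⟩
  · rw [← f.induced_symm]
    exact f.symm.polishSpace_induced
  · rw [← @isOpen_compl_iff]
    refine (hopen _).2 ⟨?_, ?_⟩
    · simp
    · simp
  · refine (hopen _).2 ⟨?_, ?_⟩
    · simp
    · rw [← Set.preimage_inter_range, Subtype.range_coe]
      simp
  · intro V hV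
    obtain ⟨⟨A, hA, hAV⟩, B, hB, hBV⟩ := (hopen V).1 hV
    refine ⟨A, B, hA, hB, ?_⟩
    ext x
    by_cases hx : x ∈ s
    · have : x ∈ A ↔ x ∈ V := Set.ext_iff.1 hAV ⟨x, hx⟩
      simp [hx, this]
    · have : x ∈ B ↔ x ∈ V := Set.ext_iff.1 hBV ⟨x, hx⟩
      simp [hx, this]

section Refinement

variable {X : Type*} [MulAction SInf X]

/-- A topology refining `t₀` and making the space a Polish `S_∞`-space. -/
structure IsPolishRefinement (t₀ t : TopologicalSpace X) : Prop where
  le : t ≤ t₀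
  polish : @PolishSpace X t
  smul : @ContinuousSMul SInf X _ _ t

theorem IsPolishRefinement.iInf {t₀ : TopologicalSpace X} (h₀ : IsPolishRefinement t₀ t₀)
    {ι : Type*} [Countable ι] {t : ι → TopologicalSpace X}
    (h : ∀ i, IsPolishRefinement t₀ (t i)) :
    ∃ t', IsPolishRefinement t₀ t' ∧ ∀ i, t' ≤ t i := by
  -- The index `none` supplies `t₀`, the common coarser topology, even when `ι` is empty.
  refine ⟨⨅ i : Option ι, i.elim t₀ t, ⟨iInf_le _ none, ?_, ?_⟩, fun i => iInf_le _ (some i)⟩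
  · exact .iInf ⟨none, Option.forall.2 ⟨le_rfl, fun i => (h i).le⟩⟩
      (Option.forall.2 ⟨h₀.polish, fun i => (h i).polish⟩)
  · exact continuousSMul_iInf (Option.forall.2 ⟨h₀.smul, fun i => (h i).smul⟩)

/-- Countably many open sets permuted by the action like the `n`-tuples of natural numbers can be
made clopen. -/
theorem IsPolishRefinement.exists_isClopen {t₀ t : TopologicalSpace X}
    (h : IsPolishRefinement t₀ t) {n : ℕ} {U : (Fin n → ℕ) → Set X} (hU : ∀ s, IsOpen[t] (U s))
    (hinv : ∀ (g : SInf) x s, g • x ∈ U s ↔ x ∈ U fun i => g⁻¹ (s i)) :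
    ∃ t', IsPolishRefinement t₀ t' ∧ ∀ s, @IsClopen _ t' (U s) := by
  have hpol := h.polish
  choose τ hle hτ hclopen hopen using fun s => exists_polishSpace_isClopen (hU s)
  have hle' : (⨅ s : Option (Fin n → ℕ), s.elim t τ) ≤ t := iInf_le _ none
  have hcl : ∀ s, @IsClopen X (⨅ s : Option (Fin n → ℕ), s.elim t τ) (U s) := fun s =>
    ⟨(hclopen s).1.mono (iInf_le (fun s : Option (Fin n → ℕ) => s.elim t τ) (some s)),
      (hclopen s).2.mono (iInf_le (fun s : Option (Fin n → ℕ) => s.elim t τ) (some s))⟩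
  refine ⟨⨅ s : Option (Fin n → ℕ), s.elim t τ, ⟨hle'.trans h.le, ?_, ?_⟩, hcl⟩
  · exact .iInf ⟨none, Option.forall.2 ⟨le_rfl, hle⟩⟩ (Option.forall.2 ⟨hpol, hτ⟩)
  · have hsm := h.smul
    have hcont : @Continuous (SInf × X) X
        (@instTopologicalSpaceProd SInf X _ (⨅ s : Option (Fin n → ℕ), s.elim t τ)) t
        fun p => p.1 • p.2 :=
      continuous_le_dom (inf_le_inf le_rfl (induced_mono hle')) continuous_smul
    let t' : TopologicalSpace X := ⨅ s : Option (Fin n → ℕ), s.elim t τ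
    -- Since the action permutes the sets `C s`, each preimage is a union of open rectangles.
    have hpre : ∀ (C : (Fin n → ℕ) → Set X), (∀ s, IsOpen[t'] (C s)) →
        (∀ (g : SInf) x s, g • x ∈ C s ↔ x ∈ C fun i => g⁻¹ (s i)) → ∀ s,
        IsOpen[@instTopologicalSpaceProd SInf X _ t'] ((fun p : SInf × X => p.1 • p.2) ⁻¹' C s) := by
      intro C hC hCinv s
      have : (fun p : SInf × X => p.1 • p.2) ⁻¹' C s =
          ⋃ r : Fin n → ℕ, {g : SInf | ∀ i, g⁻¹ (s i) = r i} ×ˢ C r := by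
        ext p
        simp only [Set.mem_preimage, hCinv, Set.mem_iUnion, Set.mem_prod, Set.mem_ofPred_eq]
        constructor
        · exact fun h => ⟨_, fun i => rfl, h⟩
        · rintro ⟨r, hr, h⟩
          rwa [funext hr]
      rw [this]
      refine @isOpen_iUnion _ _ (_) _ fun r => @IsOpen.prod _ _ _ t' _ _ ?_ (hC r)
      simp only [Set.ofPred_forall]
      exact isOpen_iInter_of_finite fun i => isOpen_inv_apply_eq (s i) (r i)
    refine @ContinuousSMul.mk SInf X _ _ t' (continuous_iInf_rng.2 (Option.forall.2 ⟨hcont, ?_⟩))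
    intro s
    have hcont' := (@continuous_def _ _ (_) t _).1 hcont
    refine @Continuous.mk _ _ (_) (_) _ fun V hV => ?_
    obtain ⟨A, B, hA, hB, rfl⟩ := hopen s V hV
    rw [Set.preimage_union, Set.preimage_inter, Set.sdiff_eq, Set.preimage_inter]
    refine @IsOpen.union _ _ _ (_) (@IsOpen.inter _ _ _ (_) (hcont' _ hA) ?_)
      (@IsOpen.inter _ _ _ (_) (hcont' _ hB) ?_)
    · exact hpre U (fun s => (hcl s).2) hinv s
    · exact hpre (fun s => (U s)ᶜ) (fun s => (@IsClosed.isOpen_compl _ t' _ (hcl s).1))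
        (fun g x s => not_congr (hinv g x s)) s

end Refinement

/-! ### Invariance of satisfaction and sets of models -/

section Models

variable {L : FirstOrder.Language.{0, 0}} [L.IsRelational]

theorem isoSetoid_iff_orbitRel (x y : StrSpace L) :
    isoSetoid L x y ↔ MulAction.orbitRel SInf (StrSpace L) x y := by
  rw [MulAction.orbitRel_apply, MulAction.mem_orbit_iff]
  constructor
  · rintro ⟨e⟩
    -- The orbit relation asks for `g • y = x`, whereas `e` goes from `x` to `y`.
    refine ⟨(@FirstOrder.Language.Equiv.toEquiv L ℕ ℕ x.toStructure y.toStructure e)⁻¹, ?_⟩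
    funext R s
    rw [smul_strSpace_apply, inv_inv, Bool.eq_iff_iff]
    exact @FirstOrder.Language.Equiv.map_rel' L ℕ ℕ x.toStructure y.toStructure e _ R.2 s
  · rintro ⟨g, rfl⟩
    refine ⟨@FirstOrder.Language.Equiv.mk L ℕ ℕ (StrSpace.toStructure (g • y)) y.toStructure g⁻¹
      (fun f => isEmptyElim f) fun R s => ?_⟩
    exact Iff.rfl

theorem isoSetoid_eq_orbitRel : isoSetoid L = MulAction.orbitRel SInf (StrSpace L) :=
  Setoid.ext isoSetoid_iff_orbitRel

theorem realize_term_smul (g : SInf) (x : StrSpace L) {n : ℕ} (t : L.Term (Fin n))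
    (v : Fin n → ℕ) : @FirstOrder.Language.Term.realize L ℕ x.toStructure _
      (fun i => g⁻¹ (v i)) t =
      g⁻¹ (@FirstOrder.Language.Term.realize L ℕ (StrSpace.toStructure (g • x)) _ v t) := by
  cases t with
  | var i => rfl
  | func f _ => exact isEmptyElim f

theorem InfFormula.holds_smul (g : SInf) (x : StrSpace L) {n : ℕ} (φ : InfFormula L n)
    (v : Fin n → ℕ) : φ.Holds (g • x) v ↔ φ.Holds x fun i => g⁻¹ (v i) := by
  have hsnoc : ∀ {n : ℕ} (v : Fin n → ℕ) (a : ℕ), (fun i => g⁻¹ (Fin.snoc (α := fun _ => ℕ) v a i))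
      = Fin.snoc (α := fun _ => ℕ) (fun i => g⁻¹ (v i)) (g⁻¹ a) := fun v a =>
    Fin.comp_snoc (g⁻¹ : SInf) v a
  induction φ with
  | falsum => exact Iff.rfl
  | equal t₁ t₂ =>
    simp only [InfFormula.Holds, InfFormula.Realize, realize_term_smul,
      EmbeddingLike.apply_eq_iff_eq]
  | rel R ts =>
    simp only [InfFormula.Holds, InfFormula.Realize, realize_term_smul]
    exact Iff.rfl
  | neg φ ih => exact not_congr (ih v)
  | conj φ ih => exact forall_congr' fun i => ih i v
  | disj φ ih => exact exists_congr fun i => ih i v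
  | all φ ih =>
    refine (forall_congr' fun a => (ih _).trans (iff_of_eq (by rw [hsnoc]))).trans
      (g⁻¹.surjective.forall (p := fun a => φ.Holds x (Fin.snoc (fun i => g⁻¹ (v i)) a))).symm
  | ex φ ih =>
    refine (exists_congr fun a => (ih _).trans (iff_of_eq (by rw [hsnoc]))).trans
      (g⁻¹.surjective.exists (p := fun a => φ.Holds x (Fin.snoc (fun i => g⁻¹ (v i)) a))).symm

theorem InfFormula.smul_mem_models (φ : InfFormula L 0) (g : SInf) {x : StrSpace L}
    (hx : x ∈ φ.models) : g • x ∈ φ.models := by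
  refine (φ.holds_smul g x _).2 ?_
  rwa [Subsingleton.elim (fun i => g⁻¹ (Fin.elim0 i)) (Fin.elim0 : Fin 0 → ℕ)]

/-- One step for connectives and quantifiers alike: over `ℕ` a quantifier is a countable connective.
In a common refinement the new sets are all open or all closed, and
`IsPolishRefinement.exists_isClopen` makes them clopen. -/
theorem InfFormula.exists_polishRefinement_of_forall {t₀ : TopologicalSpace (StrSpace L)}
    (h₀ : IsPolishRefinement t₀ t₀) {ι : Type*} [Countable ι] {n : ℕ} (φ : InfFormula L n)
    {k : ι → ℕ} (ψ : ∀ i, InfFormula L (k i)) (e : ∀ i, (Fin n → ℕ) → Fin (k i) → ℕ)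
    (hφ : (∀ v, {x | φ.Holds x v} = ⋃ i, {x | (ψ i).Holds x (e i v)}) ∨
      ∀ v, {x | φ.Holds x v} = ⋂ i, {x | (ψ i).Holds x (e i v)})
    (hψ : ∀ i, ∃ t, IsPolishRefinement t₀ t ∧ ∀ v, @IsClopen _ t {x | (ψ i).Holds x v}) :
    ∃ t, IsPolishRefinement t₀ t ∧ ∀ v, @IsClopen _ t {x | φ.Holds x v} := by
  choose t ht hcl using hψ
  obtain ⟨t', ht', hle⟩ := IsPolishRefinement.iInf h₀ ht
  rcases hφ with hφ | hφ
  · refine ht'.exists_isClopen (fun s => ?_) fun g x s => φ.holds_smul g x s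
    rw [hφ]
    exact @isOpen_iUnion _ _ t' _ fun i => (hcl i _).2.mono (hle i)
  · have hop : ∀ v, IsOpen[t'] {x | φ.Holds x v}ᶜ := fun v => by
      rw [hφ]
      exact @IsClosed.isOpen_compl _ t' _
        (@isClosed_iInter _ _ t' _ fun i => (hcl i _).1.mono (hle i))
    obtain ⟨t'', ht'', h⟩ := ht'.exists_isClopen hop fun g x s => not_congr (φ.holds_smul g x s)
    exact ⟨t'', ht'', fun v => compl_compl {x | φ.Holds x v} ▸ @IsClopen.compl _ t'' _ (h v)⟩

/-- The sets defined by a formula become clopen in a finer topology for which the logic action is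
still a continuous action on a Polish space. -/
theorem InfFormula.exists_polishRefinement [Countable L.Symbols] {n : ℕ} (φ : InfFormula L n) :
    ∃ t, IsPolishRefinement (instTopStrSpace L) t ∧ ∀ v, @IsClopen _ t {x | φ.Holds x v} := by
  have h₀ : IsPolishRefinement (instTopStrSpace L) (instTopStrSpace L) :=
    ⟨le_rfl, inferInstance, inferInstance⟩
  have hterm : ∀ {n : ℕ} (t : L.Term (Fin n)), ∃ i, t = .var i := fun t => by
    cases t with
    | var i => exact ⟨i, rfl⟩
    | func f _ => exact isEmptyElim f
  induction φ with
  | falsum => exact ⟨_, h₀, fun v => isClopen_empty⟩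
  | equal t₁ t₂ =>
    obtain ⟨i, rfl⟩ := hterm t₁
    obtain ⟨j, rfl⟩ := hterm t₂
    refine ⟨_, h₀, fun v => ?_⟩
    change IsClopen {_x : StrSpace L | v i = v j}
    by_cases h : v i = v j <;> simp [h, isClopen_univ, isClopen_empty]
  | rel R ts =>
    choose i hi using fun j => hterm (ts j)
    obtain rfl : ts = fun j => .var (i j) := funext hi
    exact ⟨_, h₀, fun v => isClopen_atomic L ⟨_, R⟩ (fun j => v (i j)) true⟩
  | neg φ ih =>
    obtain ⟨t, ht, h⟩ := ih
    exact ⟨t, ht, fun v => @IsClopen.compl _ t _ (h v)⟩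
  | conj φ ih =>
    exact InfFormula.exists_polishRefinement_of_forall h₀ _ φ (fun _ v => v)
      (.inr fun v => by ext x; rw [Set.mem_iInter]; exact Iff.rfl) ih
  | disj φ ih =>
    exact InfFormula.exists_polishRefinement_of_forall h₀ _ φ (fun _ v => v)
      (.inl fun v => by ext x; rw [Set.mem_iUnion]; exact Iff.rfl) ih
  | all φ ih =>
    exact InfFormula.exists_polishRefinement_of_forall h₀ _ (fun _ : ℕ => φ)
      (fun a v => Fin.snoc (α := fun _ => ℕ) v a)
      (.inr fun v => by ext x; rw [Set.mem_iInter]; exact Iff.rfl) fun _ => ih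
  | ex φ ih =>
    exact InfFormula.exists_polishRefinement_of_forall h₀ _ (fun _ : ℕ => φ)
      (fun a v => Fin.snoc (α := fun _ => ℕ) v a)
      (.inl fun v => by ext x; rw [Set.mem_iUnion]; exact Iff.rfl) fun _ => ih

theorem InfFormula.measurableSet_models [Countable L.Symbols] (φ : InfFormula L 0) :
    MeasurableSet φ.models := by
  obtain ⟨t, ht, h⟩ := φ.exists_polishRefinement
  -- Comparable Polish topologies have the same Borel sets.
  have := @borel_eq_borel_of_le _ t (instTopStrSpace L) ht.polish (instPolishStrSpace L) ht.le
  change @MeasurableSet _ (@borel _ (instTopStrSpace L)) _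
  rw [← this]
  exact @MeasurableSpace.measurableSet_generateFrom _ {s | IsOpen[t] s} _ (h Fin.elim0).2

end Models

/-! ### Equivalence of Vaught's conjecture and its topological forms -/

/-- Assuming Vaught's conjecture, every invariant Borel subset of a Borel `S_∞`-space contains
countably many orbits or an uncountable Borel partial transversal. -/
theorem VaughtConjecture.countablyManyClasses_or_exists_measurableSet (h : VaughtConjecture)
    {X : Type u} [MeasurableSpace X] [StandardBorelSpace X] [MulAction SInf X]
    [MeasurableSMul₂ SInf X] {B : Set X} (hB : MeasurableSet B)
    (hinv : ∀ (g : SInf), ∀ x ∈ B, g • x ∈ B) :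
    CountablyManyClasses (MulAction.orbitRel SInf X) B ∨
      ∃ P ⊆ B, MeasurableSet P ∧ ¬ P.Countable ∧
        P.Pairwise fun x y => ¬ MulAction.orbitRel SInf X x y := by
  obtain ⟨π, hπ, hinj, hsmul⟩ := isUniversalBorelSpace_LInf.{u}.2.2 X
  obtain ⟨φ, hφ⟩ := exists_models_eq (hB.image_of_measurable_injOn hπ hinj.injOn) <| by
    rintro g _ ⟨x, hx, rfl⟩
    exact ⟨g • x, hinv g x hx, hsmul g x⟩
  have hrel := orbitRel_map_iff hinj hsmul
  have hVC := h LInf φ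
  rw [hφ, isoSetoid_eq_orbitRel] at hVC
  refine hVC.imp (countablyManyClasses_image_iff fun x _ y _ => hrel x y).1 ?_
  rintro ⟨P, hPB, hP, hne, hpw⟩
  -- `P` lies in the image of `π`, so its preimage is still uncountable.
  refine ⟨π ⁻¹' P, fun x hx => ?_, hπ hP.closed.measurableSet, fun hc => ?_, ?_⟩
  · exact (hinj.mem_set_image).1 (hPB hx)
  · refine not_countable_of_perfect hP hne ((hc.image π).mono fun y hy => ?_)
    obtain ⟨x, -, rfl⟩ := hPB hy
    exact ⟨x, hy, rfl⟩
  · exact fun x hx y hy hxy hr => hpw hx hy (hinj.ne hxy) ((hrel x y).1 hr)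

theorem VaughtConjecture.tvcI (h : VaughtConjecture) : TVCI.{u} SInf := by
  intro X _ _ _ _ B hB hinv
  let _ : MeasurableSpace X := borel X
  have : BorelSpace X := ⟨rfl⟩
  refine (h.countablyManyClasses_or_exists_measurableSet hB hinv).imp_right ?_
  rintro ⟨P, hPB, hP, hunc, hpw⟩
  exact perfectlyManyClasses_of_measurableSet hP hunc hPB hpw

theorem VaughtConjecture.tvcIII (h : VaughtConjecture) : TVCIII.{u} SInf := by
  intro X _ _ _ _
  refine (h.countablyManyClasses_or_exists_measurableSet MeasurableSet.univ
    fun _ _ _ => mem_univ _).imp_right ?_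
  rintro ⟨P, -, hP⟩
  exact ⟨P, hP⟩

theorem TVCI.tvcII (h : TVCI.{u} SInf) : TVCII.{u} SInf := fun X _ _ _ _ =>
  h X univ (@MeasurableSet.univ X (borel X)) fun _ _ _ => mem_univ _

/-! ### Sets of models as `S_∞`-spaces -/

section Models

variable {L : FirstOrder.Language.{0, 0}} [L.IsRelational]

/-- The logic action on the invariant set of models of a sentence. -/
instance instActionModels (φ : InfFormula L 0) : MulAction SInf φ.models where
  smul g x := ⟨g • x.1, φ.smul_mem_models g x.2⟩
  one_smul x := Subtype.ext (one_smul SInf x.1)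
  mul_smul g h x := Subtype.ext (mul_smul g h x.1)

/-- The inclusion of a lifted space of models into the space of structures. -/
def modelsInclusion (φ : InfFormula L 0) (x : ULift.{u} φ.models) : StrSpace L := x.down.1

variable (φ : InfFormula L 0)

theorem modelsInclusion_injective : Function.Injective (modelsInclusion.{u} φ) :=
  Subtype.val_injective.comp ULift.down_injective

theorem modelsInclusion_mem (x : ULift.{u} φ.models) : modelsInclusion φ x ∈ φ.models := x.down.2

theorem image_modelsInclusion : modelsInclusion.{u} φ '' univ = φ.models := by
  ext x
  constructor
  · rintro ⟨y, -, rfl⟩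
    exact modelsInclusion_mem φ y
  · exact fun hx => ⟨⟨⟨x, hx⟩⟩, mem_univ _, rfl⟩

theorem orbitRel_modelsInclusion_iff (x y : ULift.{u} φ.models) :
    MulAction.orbitRel SInf _ x y ↔
      isoSetoid L (modelsInclusion φ x) (modelsInclusion φ y) := by
  rw [isoSetoid_eq_orbitRel]
  exact orbitRel_map_iff (modelsInclusion_injective φ) (fun _ _ => rfl) x y

theorem CountablyManyClasses.of_modelsInclusion
    (h : CountablyManyClasses (MulAction.orbitRel SInf (ULift.{u} φ.models)) univ) :
    CountablyManyClasses (isoSetoid L) φ.models := by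
  rw [← image_modelsInclusion.{u} φ]
  exact (countablyManyClasses_image_iff fun x _ y _ => orbitRel_modelsInclusion_iff φ x y).2 h

theorem exists_polishSpace_models [Countable L.Symbols] :
    ∃ τ : TopologicalSpace φ.models, @PolishSpace _ τ ∧ @ContinuousSMul SInf φ.models _ _ τ ∧
      @Continuous _ _ τ (instTopStrSpace L) (Subtype.val : φ.models → StrSpace L) := by
  obtain ⟨t, ht, hcl⟩ := φ.exists_polishRefinement
  have hpol := ht.polish
  have hsm := ht.smul
  refine ⟨.induced Subtype.val t, @IsClosed.polishSpace _ t _ _ (hcl Fin.elim0).1, ?_,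
    continuous_le_rng ht.le continuous_induced_dom⟩
  exact (IsInducing.subtypeVal : IsInducing (Subtype.val : φ.models → StrSpace L)).continuousSMul
    continuous_id rfl

end Models

/-- The hypothesis concerns spaces in universe `u`, hence the lift. A perfect set for the refined
topology yields one for the original by `PerfectlyManyClasses.map`. -/
theorem TVCII.vaughtConjecture (h : TVCII.{u} SInf) : VaughtConjecture := by
  intro L _ _ φ
  obtain ⟨τ, hτ, hsm, hval⟩ := exists_polishSpace_models φ
  have hpol : PolishSpace (ULift.{u} φ.models) := IsClosedEmbedding.uliftDown.polishSpace
  have hsm' : ContinuousSMul SInf (ULift.{u} φ.models) :=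
    ⟨continuous_uliftUp.comp (continuous_fst.smul (continuous_uliftDown.comp continuous_snd))⟩
  refine (h (ULift.{u} φ.models)).imp (CountablyManyClasses.of_modelsInclusion φ) fun hP => ?_
  exact hP.map (f := modelsInclusion φ) (hval.comp continuous_uliftDown)
    (modelsInclusion_injective φ) (fun x _ => modelsInclusion_mem φ x)
    fun x y => (orbitRel_modelsInclusion_iff φ x y).2

theorem standardBorelSpace_ulift {X : Type*} [MeasurableSpace X] [StandardBorelSpace X] :
    StandardBorelSpace (ULift.{u} X) := by
  let := upgradeStandardBorel X
  have : PolishSpace (ULift.{u} X) := IsClosedEmbedding.uliftDown.polishSpace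
  have : BorelSpace (ULift.{u} X) :=
    MeasurableEquiv.ulift.measurableEmbedding.borelSpace IsEmbedding.uliftDown.isInducing
  infer_instance

/-- By Lusin–Souslin the uncountable Borel set of inequivalent models stays Borel among all
structures, where the perfect set theorem applies. -/
theorem TVCIII.vaughtConjecture (h : TVCIII.{u} SInf) : VaughtConjecture := by
  intro L _ _ φ
  have hsb : StandardBorelSpace φ.models := φ.measurableSet_models.standardBorel
  have hsb' : StandardBorelSpace (ULift.{u} φ.models) := standardBorelSpace_ulift
  have hsm : MeasurableSMul₂ SInf (ULift.{u} φ.models) := by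
    refine ⟨measurable_up.comp (Measurable.subtype_mk ?_)⟩
    exact (measurable_fst.smul (measurable_subtype_coe.comp (measurable_down.comp measurable_snd)) :
      Measurable fun p : SInf × ULift.{u} φ.models => p.1 • p.2.down.1)
  have hmeas : Measurable (modelsInclusion.{u} φ) := measurable_subtype_coe.comp measurable_down
  have hinj := modelsInclusion_injective.{u} φ
  refine (h (ULift.{u} φ.models)).imp (CountablyManyClasses.of_modelsInclusion φ) ?_
  rintro ⟨P, hP, hunc, hpw⟩
  refine perfectlyManyClasses_of_measurableSet (P := modelsInclusion φ '' P)
    (hP.image_of_measurable_injOn hmeas hinj.injOn)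
    (fun hc => hunc (Set.countable_of_injective_of_countable_image hinj.injOn hc)) ?_ ?_
  · rintro _ ⟨x, -, rfl⟩
    exact modelsInclusion_mem φ x
  · rintro _ ⟨x, hx, rfl⟩ _ ⟨y, hy, rfl⟩ hxy hr
    exact hpw hx hy (fun e => hxy (e ▸ rfl)) ((orbitRel_modelsInclusion_iff φ x y).2 hr)

end LogicActions

theorem corollary2p2 :
    LogicActions.IsUniversalBorelSpace.{u} LogicActions.SInf
        (LogicActions.StrSpace LogicActions.LInf) ∧
      (LogicActions.VaughtConjecture ↔ LogicActions.TVCI.{u} LogicActions.SInf) ∧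
      (LogicActions.VaughtConjecture ↔ LogicActions.TVCII.{u} LogicActions.SInf) ∧
      (LogicActions.VaughtConjecture ↔ LogicActions.TVCIII.{u} LogicActions.SInf) :=
  ⟨LogicActions.isUniversalBorelSpace_LInf,
    ⟨fun h => h.tvcI, fun h => h.tvcII.vaughtConjecture⟩,
    ⟨fun h => h.tvcI.tvcII, fun h => h.vaughtConjecture⟩,
    ⟨fun h => h.tvcIII, fun h => h.vaughtConjecture⟩⟩
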